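/- Let $1<s\le 2$, let $T(x)=\min\{sx,\,s(1-x)\}$ be the tent map on $[0,1]$ with critical point $c=\tfrac12$, write $c_k=T^k(c)$, and assume that the orbit of $c$ is infinite. Let $\omega(c)$ be the omega-limit set of $c$. For $S\subset[0,1]$ let $$\varprojlim(S,T)=\{(x_0,x_{-1},x_{-2},\dots): x_{-i}\in S,\ T(x_{-i-1})=x_{-i}\text{ for all } i\ge 0\}$$ with the product topology, and put $X=\varprojlim([0,1],T)$ and $X'=\varprojlim([c_2,c_1],T)\subset X$. Let $\mathcal E$ be the set of endpoints of $X$, i.e. of those $x\in X$ such that any two subcontinua (non-empty compact connected subsets) $A,B\subset X$ containing $x$ satisfy $A\subset B$ or $B\subset A$. Let $\mathcal F$ be the set of folding points, i.e. of those $x\in X'$ that have no neighbourhood in $X'$ homeomorphic to the product of a Cantor set and an open arc. If $\mathcal F\setminus\mathcal E\neq\emptyset$, then $\mathcal F\setminus\mathcal E$ is dense in $\mathcal F$. The same holds if $\mathcal F$ is replaced by $\varprojlim(\omega(c),T)$ (which describes the folding points by their projections): if $\varprojlim(\omega(c),T)\setminus\mathcal E\ne\emptyset$, then this set is dense in $\varprojlim(\omega(c),T)$.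 -/

import Mathlib

open Set Topology Filter

noncomputable section

namespace TentInverseLimit

/-- The symmetric tent map of slope `s`, considered for points of `[0,1]`. -/
def tent (s : ℝ) (x : ℝ) : ℝ := min (s * x) (s * (1 - x))

/-- The critical point of every tent map. -/
def crit : ℝ := 1 / 2

/-- The points `c_k = T^k(c)` of the critical orbit. -/
def critOrbit (s : ℝ) (k : ℕ) : ℝ := (tent s)^[k] crit

/-- The inverse limit of `T` on `S`, i.e. the set of all backward orbits of `T` in `S`.
The coordinate `x i` is the projection `π_i(x)`, written `x_{-i}` when backward orbits are
indexed by the non-positive integers.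
All topological notions refer to the product topology of `ℕ → ℝ`. -/
def invLim (T : ℝ → ℝ) (S : Set ℝ) : Set (ℕ → ℝ) :=
  {x | (∀ i, x i ∈ S) ∧ ∀ i, T (x (i + 1)) = x i}

/-- The inverse limit space `X` of the tent map on `[0,1]`. -/
def space (s : ℝ) : Set (ℕ → ℝ) := invLim (tent s) (Icc 0 1)

/-- The core inverse limit space `X'`, the inverse limit of `T` on the core `[c_2, c_1]`. -/
def coreSpace (s : ℝ) : Set (ℕ → ℝ) :=
  invLim (tent s) (Icc (critOrbit s 2) (critOrbit s 1))

/-- The omega-limit set `ω(c)` of the critical point. -/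
def omegaCrit (s : ℝ) : Set ℝ :=
  omegaLimit atTop (fun (n : ℕ) (x : ℝ) => (tent s)^[n] x) {crit}

/-- A subcontinuum of `Y`: a non-empty compact connected subset (`IsConnected` includes
non-emptiness). -/
def IsSubcontinuum {E : Type*} [TopologicalSpace E] (Y A : Set E) : Prop :=
  A ⊆ Y ∧ IsCompact A ∧ IsConnected A

/-- The set of endpoints of `Y`: points at which any two subcontinua of `Y` are nested. -/
def endpoints {E : Type*} [TopologicalSpace E] (Y : Set E) : Set E :=
  {x | x ∈ Y ∧ ∀ A B : Set E, IsSubcontinuum Y A → IsSubcontinuum Y B →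
    x ∈ A → x ∈ B → A ⊆ B ∨ B ⊆ A}

/-- A Cantor set: a non-empty, compact, totally disconnected set without isolated points. -/
def IsCantor {E : Type*} [TopologicalSpace E] (K : Set E) : Prop :=
  K.Nonempty ∧ IsCompact K ∧ Perfect K ∧ IsTotallyDisconnected K

/-- The point `x` has a neighbourhood in `Y` which is homeomorphic to the product of a Cantor set
and an open arc. Since all Cantor sets are homeomorphic, it does not matter that `K` is taken
from `ℕ → ℝ`. -/
def HasCantorArcNhd {E : Type*} [TopologicalSpace E] (Y : Set E) (x : E) : Prop :=
  ∃ U : Set E, U ⊆ Y ∧ U ∈ 𝓝[Y] x ∧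
    ∃ K : Set (ℕ → ℝ), IsCantor K ∧ Nonempty (U ≃ₜ K × Ioo (0 : ℝ) 1)

/-- The set of folding points: the points of `X'` without a neighbourhood in `X'` that is
homeomorphic to the product of a Cantor set and an open arc. -/
def foldingPoints (s : ℝ) : Set (ℕ → ℝ) :=
  {x | x ∈ coreSpace s ∧ ¬ HasCantorArcNhd (coreSpace s) x}

/-- The inverse limit of `T` restricted to `ω(c)`. -/
def omegaSpace (s : ℝ) : Set (ℕ → ℝ) := invLim (tent s) (omegaCrit s)

end TentInverseLimit

end

noncomputable section

namespace TentInverseLimit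

/-! ### The tent map and its core -/

/-! An infinite critical orbit rules out `s = 2` and `s ^ 2 = 2`. A backward orbit that eventually
stays away from `c`, `0` and `1` lies inside an arc of `X`, so it is not an endpoint
(`notMem_endpoints`). For `s < 2` the core lies inside `(0,1)`, so on `ω(c)` only closeness to `c`
matters.

Density in the inverse limit of `ω(c)`: if `c ∉ ω(c)`, there are no endpoints in it at all. If `c ∈
ω(c)`, let `D` be the closure of the zeroth coordinates of the non-endpoints, a closed forward
invariant set. If `c ∉ D`, the critical orbit comes close to `D`, lingers there, and must leave
again on its way back to `c`. A limit of these segments, read backwards from the exit, is a backward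
orbit `u` in `ω(c)` that avoids a neighbourhood of `c` (`exists_leaving_orbit`). Then `u` is not an
endpoint, so `T(u 0) ∈ D`, against the exit. Hence `c ∈ D` and `ω(c) ⊆ D`; the shift carries this to
every coordinate.

Folding points, `s ^ 2 > 2`: they are exactly the backward orbits in `ω(c)`. Near such an orbit arcs
turn at points with a critical coordinate, which no product chart allows; elsewhere some coordinate
has a neighbourhood free of the critical orbit, over which `X'` is a Cantor set times an arc.

Folding points, `s ^ 2 < 2`: near the fixed point the core has only one preimage, so backward orbits
tending to it have arcs as neighbourhoods. They are folding points, are not endpoints, and are dense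
in all of `X'`. -/

lemma continuous_tent (s : ℝ) : Continuous (tent s) := by
  unfold tent; fun_prop

lemma tent_of_le {s x : ℝ} (hs : 1 < s) (hx : x ≤ 1 / 2) : tent s x = s * x := by
  unfold tent; apply min_eq_left; nlinarith

lemma tent_of_ge {s x : ℝ} (hs : 1 < s) (hx : 1 / 2 ≤ x) : tent s x = s * (1 - x) := by
  unfold tent; apply min_eq_right; nlinarith

lemma critOrbit_zero (s : ℝ) : critOrbit s 0 = 1 / 2 := rfl

lemma critOrbit_succ (s : ℝ) (k : ℕ) : critOrbit s (k + 1) = tent s (critOrbit s k) :=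
  Function.iterate_succ_apply' _ _ _

lemma iterate_critOrbit (s : ℝ) (j k : ℕ) :
    (tent s)^[j] (critOrbit s k) = critOrbit s (j + k) :=
  (Function.iterate_add_apply _ _ _ _).symm

lemma critOrbit_one {s : ℝ} (hs : 1 < s) : critOrbit s 1 = s / 2 := by
  rw [critOrbit_succ, critOrbit_zero, tent_of_le hs le_rfl]; ring

lemma critOrbit_two {s : ℝ} (hs : 1 < s) : critOrbit s 2 = s * (1 - s / 2) := by
  rw [critOrbit_succ, critOrbit_one hs, tent_of_ge hs (by linarith)]

lemma critOrbit_two_le_half {s : ℝ} (hs : 1 < s) : critOrbit s 2 ≤ 1 / 2 := by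
  rw [critOrbit_two hs]; nlinarith [sq_nonneg (s - 1)]

lemma critOrbit_three {s : ℝ} (hs : 1 < s) : critOrbit s 3 = s * critOrbit s 2 := by
  rw [critOrbit_succ, tent_of_le hs (critOrbit_two_le_half hs)]

/-- The core `[c_2, c_1]`. -/
abbrev core (s : ℝ) : Set ℝ := Icc (critOrbit s 2) (critOrbit s 1)

lemma tent_le {s : ℝ} (hs : 1 < s) (x : ℝ) : tent s x ≤ critOrbit s 1 := by
  rw [critOrbit_one hs]
  rcases le_total x (1 / 2) with h | h
  · rw [tent_of_le hs h]; nlinarith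
  · rw [tent_of_ge hs h]; nlinarith

lemma core_nonneg {s : ℝ} (hs : 1 < s) (hs2 : s ≤ 2) : 0 ≤ critOrbit s 2 := by
  rw [critOrbit_two hs]; nlinarith

lemma tent_mem_core {s x : ℝ} (hs : 1 < s) (hs2 : s ≤ 2) (hx : x ∈ core s) :
    tent s x ∈ core s := by
  refine ⟨?_, tent_le hs x⟩
  have h0 := core_nonneg hs hs2
  rcases le_total x (1 / 2) with h | h
  · rw [tent_of_le hs h]; nlinarith [hx.1]
  · rw [tent_of_ge hs h, critOrbit_two hs]
    have := hx.2
    rw [critOrbit_one hs] at this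
    nlinarith

lemma crit_mem_core {s : ℝ} (hs : 1 < s) : (1 / 2 : ℝ) ∈ core s :=
  ⟨critOrbit_two_le_half hs, by rw [critOrbit_one hs]; linarith⟩

lemma iterate_tent_mem_core {s x : ℝ} (hs : 1 < s) (hs2 : s ≤ 2) (hx : x ∈ core s) (n : ℕ) :
    (tent s)^[n] x ∈ core s := by
  induction n with
  | zero => exact hx
  | succ n ih => rw [Function.iterate_succ_apply']; exact tent_mem_core hs hs2 ih

lemma critOrbit_mem_core {s : ℝ} (hs : 1 < s) (hs2 : s ≤ 2) (n : ℕ) : critOrbit s n ∈ core s :=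
  iterate_tent_mem_core hs hs2 (crit_mem_core hs) n

lemma core_subset {s : ℝ} (hs : 1 < s) (hs2 : s ≤ 2) : core s ⊆ Icc 0 1 := by
  intro x hx
  have h1 := hx.2
  rw [critOrbit_one hs] at h1
  exact ⟨(core_nonneg hs hs2).trans hx.1, by linarith⟩

lemma coreSpace_subset_space {s : ℝ} (hs : 1 < s) (hs2 : s ≤ 2) : coreSpace s ⊆ space s :=
  fun _ hx => ⟨fun i => core_subset hs hs2 (hx.1 i), hx.2⟩

lemma abs_tent_sub_le {s : ℝ} (hs : 1 < s) (u v : ℝ) :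
    |tent s u - tent s v| ≤ s * |u - v| := by
  unfold tent
  refine (abs_min_sub_min_le_max _ _ _ _).trans (max_le ?_ ?_)
  · rw [← mul_sub, abs_mul, abs_of_pos (by linarith)]
  · rw [← mul_sub, abs_mul, abs_of_pos (by linarith), sub_sub_sub_cancel_left, abs_sub_comm]

lemma abs_iterate_tent_sub_le {s : ℝ} (hs : 1 < s) (u v : ℝ) (n : ℕ) :
    |(tent s)^[n] u - (tent s)^[n] v| ≤ s ^ n * |u - v| := by
  induction n with
  | zero => simp
  | succ n ih =>
    rw [Function.iterate_succ_apply', Function.iterate_succ_apply', pow_succ']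
    calc _ ≤ s * |(tent s)^[n] u - (tent s)^[n] v| := abs_tent_sub_le hs _ _
      _ ≤ s * (s ^ n * |u - v|) := by gcongr
      _ = _ := by ring

/-! ### Backward orbits -/

lemma invLim_iterate {T : ℝ → ℝ} {S : Set ℝ} {x : ℕ → ℝ} (hx : x ∈ invLim T S) (i n : ℕ) :
    T^[n] (x (i + n)) = x i := by
  induction n with
  | zero => rfl
  | succ n ih =>
    rw [Function.iterate_succ_apply, ← Nat.add_assoc, hx.2, ih]

lemma invLim_iterate_of_le {T : ℝ → ℝ} {S : Set ℝ} {x : ℕ → ℝ} (hx : x ∈ invLim T S) {i n : ℕ}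
    (h : i ≤ n) : T^[n - i] (x n) = x i := by
  obtain ⟨k, rfl⟩ := Nat.exists_eq_add_of_le h
  rw [Nat.add_sub_cancel_left]; exact invLim_iterate hx i k

/-- A backward orbit through `q` at position `N` extends a backward orbit `b` of `q`. -/
lemma extend_mem_invLim {T : ℝ → ℝ} {S : Set ℝ} (hT : MapsTo T S S) (N : ℕ) {b : ℕ → ℝ}
    (hb : b ∈ invLim T S) : (fun i => T^[N - i] (b (i - N))) ∈ invLim T S := by
  refine ⟨fun i => (hT.iterate _) (hb.1 _), fun i => ?_⟩
  rcases le_or_gt N i with h | h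
  · have h1 : N - i = 0 := by omega
    have h2 : N - (i + 1) = 0 := by omega
    have h3 : i + 1 - N = (i - N) + 1 := by omega
    simp only [h1, h2, h3, Function.iterate_zero, id, hb.2]
  · have h1 : N - i = (N - (i + 1)) + 1 := by omega
    have h2 : i + 1 - N = 0 := by omega
    have h3 : i - N = 0 := by omega
    simp only [h1, h2, h3, Function.iterate_succ_apply']

/-- The inverse branch of the tent map with values in `[c, 1]`. -/
def rightInv (s u : ℝ) : ℝ := 1 - u / s

lemma tent_rightInv {s u : ℝ} (hs : 1 < s) (hu : u ≤ critOrbit s 1) :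
    tent s (rightInv s u) = u := by
  rw [critOrbit_one hs] at hu
  have h : u / s ≤ 1 / 2 := by rw [div_le_iff₀ (by linarith)]; linarith
  rw [rightInv, tent_of_ge hs (by linarith)]
  field_simp; ring

/-- The decreasing branch sends `c_2` to `c_1`, and its values stay at or above `c`. -/
lemma rightInv_mem_core {s u : ℝ} (hs : 1 < s) (hu : u ∈ core s) : rightInv s u ∈ core s := by
  have h2 := hu.2
  have h1 := hu.1
  have hh := critOrbit_two_le_half hs
  rw [critOrbit_two hs] at h1
  rw [critOrbit_one hs] at h2
  have h3 : u / s ≤ 1 / 2 := by rw [div_le_iff₀ (by linarith)]; linarith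
  have h4 : 1 - s / 2 ≤ u / s := by rw [le_div_iff₀ (by linarith)]; linarith
  refine ⟨?_, ?_⟩ <;> unfold rightInv
  · linarith
  · rw [critOrbit_one hs]; linarith

/-- The backward orbit through `q` at position `j` which uses the right inverse branch only. -/
def coreLift (s : ℝ) (j : ℕ) (q : ℝ) : ℕ → ℝ :=
  fun i => (tent s)^[j - i] ((rightInv s)^[i - j] q)

lemma iterate_rightInv_mem {s q : ℝ} (hs : 1 < s) (hq : q ∈ core s) (n : ℕ) :
    (rightInv s)^[n] q ∈ core s := by
  induction n with
  | zero => exact hq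
  | succ n ih => rw [Function.iterate_succ_apply']; exact rightInv_mem_core hs ih

lemma coreLift_mem {s q : ℝ} (hs : 1 < s) (hs2 : s ≤ 2) (hq : q ∈ core s) (j : ℕ) :
    coreLift s j q ∈ coreSpace s := by
  refine extend_mem_invLim (b := fun n => (rightInv s)^[n] q)
    (fun x hx => tent_mem_core hs hs2 hx) j
    ⟨fun i => iterate_rightInv_mem hs hq i, fun i => ?_⟩
  simp only [Function.iterate_succ_apply']
  exact tent_rightInv hs (iterate_rightInv_mem hs hq i).2

lemma coreLift_of_le {s q : ℝ} {j i : ℕ} (h : i ≤ j) :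
    coreLift s j q i = (tent s)^[j - i] q := by
  simp [coreLift, Nat.sub_eq_zero_of_le h]

lemma coreLift_add {s q : ℝ} (j i : ℕ) : coreLift s j q (j + i) = (rightInv s)^[i] q := by
  simp [coreLift]

lemma coreLift_self {s q : ℝ} (j : ℕ) : coreLift s j q j = q := by simp [coreLift]

lemma continuous_coreLift (s : ℝ) (j : ℕ) : Continuous (coreLift s j) := by
  refine continuous_pi fun i => ?_
  have : Continuous (rightInv s) := by unfold rightInv; fun_prop
  exact ((continuous_tent s).iterate _).comp (this.iterate _)

/-- The shift homeomorphism. -/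
def shift (s : ℝ) (x : ℕ → ℝ) : ℕ → ℝ
  | 0 => tent s (x 0)
  | n + 1 => x n

lemma continuous_shift (s : ℝ) : Continuous (shift s) := by
  refine continuous_pi fun i => ?_
  cases i with
  | zero => exact (continuous_tent s).comp (continuous_apply 0)
  | succ n => exact continuous_apply n

lemma shift_mem {s : ℝ} {S : Set ℝ} (hT : MapsTo (tent s) S S) {x : ℕ → ℝ}
    (hx : x ∈ invLim (tent s) S) : shift s x ∈ invLim (tent s) S := by
  refine ⟨fun i => ?_, fun i => ?_⟩
  · cases i with
    | zero => exact hT (hx.1 0)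
    | succ n => exact hx.1 n
  · cases i with
    | zero => rfl
    | succ n => exact hx.2 n

lemma shift_tail {s : ℝ} {S : Set ℝ} {x : ℕ → ℝ} (hx : x ∈ invLim (tent s) S) :
    shift s (fun i => x (i + 1)) = x := by
  funext i
  cases i with
  | zero => exact hx.2 0
  | succ n => rfl

lemma tail_mem {s : ℝ} {S : Set ℝ} {x : ℕ → ℝ} (hx : x ∈ invLim (tent s) S) :
    (fun i => x (i + 1)) ∈ invLim (tent s) S :=
  ⟨fun _ => hx.1 _, fun _ => hx.2 _⟩

lemma shift_injective (s : ℝ) : Function.Injective (shift s) := fun x y h => by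
  funext i; exact congrFun h (i + 1)

lemma tent_mapsTo_unit {s : ℝ} (hs : 1 < s) (hs2 : s ≤ 2) :
    MapsTo (tent s) (Icc 0 1) (Icc 0 1) := fun x hx => by
  have h := tent_le hs x
  rw [critOrbit_one hs] at h
  refine ⟨?_, by linarith⟩
  unfold tent
  exact le_min (by nlinarith [hx.1]) (by nlinarith [hx.2])

/-! ### Endpoints -/

/-- The shift is a continuous injection of `X` into itself, so it preserves subcontinua, and nesting
of the images pulls back. -/
lemma shift_notMem_endpoints {s : ℝ} (hs : 1 < s) (hs2 : s ≤ 2) {x : ℕ → ℝ} (hx : x ∈ space s)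
    (h : x ∉ endpoints (space s)) : shift s x ∉ endpoints (space s) := by
  have key : ∀ A, IsSubcontinuum (space s) A → IsSubcontinuum (space s) (shift s '' A) :=
    fun A hA => ⟨by
      rintro _ ⟨a, ha, rfl⟩
      exact shift_mem (tent_mapsTo_unit hs hs2) (hA.1 ha),
      hA.2.1.image (continuous_shift s), hA.2.2.image _ (continuous_shift s).continuousOn⟩
  intro h'
  refine h ⟨hx, fun A B hA hB hxA hxB => ?_⟩
  have := h'.2 _ _ (key A hA) (key B hB) (mem_image_of_mem _ hxA) (mem_image_of_mem _ hxB)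
  rwa [image_subset_image_iff (shift_injective s), image_subset_image_iff (shift_injective s)]
    at this

/-- Orientation of `T^n` along the backward orbit `x`. -/
def orientation (x : ℕ → ℝ) : ℕ → ℝ
  | 0 => 1
  | n + 1 => if x (n + 1) ≤ 1 / 2 then orientation x n else -orientation x n

lemma abs_orientation (x : ℕ → ℝ) (n : ℕ) : |orientation x n| = 1 := by
  induction n with
  | zero => simp [orientation]
  | succ n ih => unfold orientation; split_ifs <;> simp [ih]

/-- The arc through `x` parametrized by arc length in the zeroth coordinate. -/
def localArc (s : ℝ) (x : ℕ → ℝ) (τ : ℝ) : ℕ → ℝ :=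
  fun i => x i + orientation x i * τ / s ^ i

lemma continuous_localArc (s : ℝ) (x : ℕ → ℝ) : Continuous (localArc s x) := by
  unfold localArc; fun_prop

/-- Each coordinate moves by at most `η`, so none crosses `c` or leaves `[0,1]`. The tent map
therefore acts with constant slope `±s`, and `orientation` records the sign. -/
lemma localArc_mem {s : ℝ} (hs : 1 < s) {x : ℕ → ℝ} (hx : x ∈ space s) {η : ℝ}
    (h : ∀ n, η ≤ |x n - 1 / 2| ∧ η ≤ x n ∧ x n ≤ 1 - η) {τ : ℝ} (hτ : |τ| ≤ η) :
    localArc s x τ ∈ space s := by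
  have hb : ∀ i, |orientation x i * τ / s ^ i| ≤ η := fun i => by
    rw [abs_div, abs_mul, abs_orientation, one_mul, abs_of_pos (a := s ^ i) (by positivity)]
    exact (div_le_self (abs_nonneg _) (one_le_pow₀ hs.le)).trans hτ
  refine ⟨fun i => ?_, fun i => ?_⟩
  · have := abs_le.1 (hb i)
    have h2 := h i
    exact ⟨by simp only [localArc]; linarith, by simp only [localArc]; linarith⟩
  · have h1 := abs_le.1 (hb (i + 1))
    have h2 := (h (i + 1)).1
    have h3 := hx.2 i
    simp only [localArc]
    have hs0 : s ≠ 0 := by linarith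
    by_cases hc : x (i + 1) ≤ 1 / 2
    · rw [abs_of_nonpos (by linarith)] at h2
      rw [tent_of_le hs hc] at h3
      rw [tent_of_le hs (by linarith), ← h3]
      simp only [orientation, if_pos hc]
      field_simp
      ring
    · rw [abs_of_nonneg (by linarith)] at h2
      rw [tent_of_ge hs (by linarith)] at h3
      rw [tent_of_ge hs (by linarith), ← h3]
      simp only [orientation, if_neg hc]
      field_simp
      ring

/-- The two halves of the arc on either side of `x` are subcontinua, and the zeroth coordinate shows
that neither contains the other. -/
lemma notMem_endpoints_of_forall {s : ℝ} (hs : 1 < s) {x : ℕ → ℝ} (hx : x ∈ space s) {η : ℝ}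
    (hη : 0 < η) (h : ∀ n, η ≤ |x n - 1 / 2| ∧ η ≤ x n ∧ x n ≤ 1 - η) :
    x ∉ endpoints (space s) := by
  intro hE
  have key : ∀ a b : ℝ, a ≤ b → -η ≤ a → b ≤ η →
      IsSubcontinuum (space s) (localArc s x '' Icc a b) := fun a b hab ha hb => by
    refine ⟨?_, isCompact_Icc.image (continuous_localArc s x),
      (isConnected_Icc hab).image _ (continuous_localArc s x).continuousOn⟩
    rintro _ ⟨τ, hτ, rfl⟩
    exact localArc_mem hs hx h (abs_le.2 ⟨ha.trans hτ.1, hτ.2.trans hb⟩)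
  have h0 : localArc s x 0 = x := by funext i; simp [localArc]
  have hz : ∀ τ, localArc s x τ 0 = x 0 + τ := fun τ => by simp [localArc, orientation]
  rcases hE.2 _ _ (key (-η) 0 (by linarith) le_rfl hη.le) (key 0 η hη.le (by linarith) le_rfl)
    ⟨0, by simp [hη.le], h0⟩ ⟨0, by simp [hη.le], h0⟩ with hAB | hAB
  · obtain ⟨τ, hτ, he⟩ := hAB ⟨-η, by simp [hη.le], rfl⟩
    have := congrFun he 0
    rw [hz, hz] at this
    linarith [hτ.1]
  · obtain ⟨τ, hτ, he⟩ := hAB ⟨η, by simp [hη.le], rfl⟩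
    have := congrFun he 0
    rw [hz, hz] at this
    linarith [hτ.2]

/-- A backward orbit which eventually stays away from the critical point and from the boundary
of `[0,1]` is not an endpoint. -/
lemma notMem_endpoints {s : ℝ} (hs : 1 < s) (hs2 : s ≤ 2) {x : ℕ → ℝ} (hx : x ∈ space s) {η : ℝ}
    (hη : 0 < η) (N : ℕ) (h : ∀ n, N ≤ n → η ≤ |x n - 1 / 2| ∧ η ≤ x n ∧ x n ≤ 1 - η) :
    x ∉ endpoints (space s) := by
  induction N generalizing x with
  | zero => exact notMem_endpoints_of_forall hs hx hη fun n => h n (Nat.zero_le n)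
  | succ N ih =>
    have := shift_notMem_endpoints hs hs2 (tail_mem hx)
      (ih (tail_mem hx) fun n hn => h (n + 1) (by omega))
    rwa [shift_tail hx] at this

/-! ### Infinite critical orbits -/

lemma finite_range_critOrbit {s : ℝ} {n : ℕ} (h : critOrbit s (n + 1) = critOrbit s n) :
    (range (critOrbit s)).Finite := by
  have h2 : ∀ k, critOrbit s (n + k) = critOrbit s n := fun k => by
    induction k with
    | zero => rfl
    | succ k ih => rw [← Nat.add_assoc, critOrbit_succ, ih, ← critOrbit_succ, h]
  refine ((finite_Iic n).image (critOrbit s)).subset ?_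
  rintro _ ⟨k, rfl⟩
  rcases le_total k n with hk | hk
  · exact ⟨k, hk, rfl⟩
  · obtain ⟨j, rfl⟩ := Nat.exists_eq_add_of_le hk
    exact ⟨n, self_mem_Iic, (h2 j).symm⟩

/-- For slope `2`, `c_2 = 0` is a fixed point. -/
lemma lt_two {s : ℝ} (hs : 1 < s) (hs2 : s ≤ 2) (horb : (range (critOrbit s)).Infinite) :
    s < 2 := by
  refine lt_of_le_of_ne hs2 ?_
  rintro rfl
  refine horb (finite_range_critOrbit (n := 2) ?_)
  rw [critOrbit_three hs, critOrbit_two hs]; norm_num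

/-- If `s ^ 2 = 2`, then `c_3 = 2 - s` is the fixed point in `[c, 1]`. -/
lemma sq_ne_two {s : ℝ} (hs : 1 < s) (horb : (range (critOrbit s)).Infinite) :
    s ^ 2 ≠ 2 := by
  intro h
  refine horb (finite_range_critOrbit (n := 3) ?_)
  have h3 : critOrbit s 3 = 2 - s := by
    rw [critOrbit_three hs, critOrbit_two hs]
    linear_combination (1 - s / 2) * h
  rw [critOrbit_succ, h3, tent_of_ge hs (by nlinarith)]
  linear_combination h

lemma critOrbit_two_pos {s : ℝ} (hs : 1 < s) (hs2 : s < 2) : 0 < critOrbit s 2 := by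
  rw [critOrbit_two hs]; nlinarith

/-! ### The omega-limit set of the critical point -/

lemma mem_omegaCrit {s y : ℝ} :
    y ∈ omegaCrit s ↔ MapClusterPt y atTop (critOrbit s) := by
  rw [omegaCrit, mem_omegaLimit_singleton_iff_mapClusterPt]
  rfl

lemma frequently_of_mem_omegaCrit {s y : ℝ} (hy : y ∈ omegaCrit s) {U : Set ℝ} (hU : U ∈ 𝓝 y) :
    ∃ᶠ n in atTop, critOrbit s n ∈ U :=
  (mapClusterPt_iff_frequently.1 (mem_omegaCrit.1 hy)) U hU

lemma isClosed_omegaCrit (s : ℝ) : IsClosed (omegaCrit s) := isClosed_omegaLimit _ _ _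

lemma tent_mem_omegaCrit {s x : ℝ} (hx : x ∈ omegaCrit s) : tent s x ∈ omegaCrit s := by
  rw [mem_omegaCrit, mapClusterPt_iff_frequently]
  intro U hU
  have h := frequently_of_mem_omegaCrit hx ((continuous_tent s).continuousAt hU)
  rw [frequently_atTop] at h ⊢
  intro a
  obtain ⟨b, hb, hb'⟩ := h a
  exact ⟨b + 1, by omega, by rw [critOrbit_succ]; exact hb'⟩

lemma omegaCrit_subset_core {s : ℝ} (hs : 1 < s) (hs2 : s ≤ 2) : omegaCrit s ⊆ core s := by
  intro y hy
  by_contra h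
  obtain ⟨n, hn⟩ := (frequently_of_mem_omegaCrit hy (isClosed_Icc.isOpen_compl.mem_nhds h)).exists
  exact hn (critOrbit_mem_core hs hs2 n)

lemma omegaSpace_subset_coreSpace {s : ℝ} (hs : 1 < s) (hs2 : s ≤ 2) :
    omegaSpace s ⊆ coreSpace s :=
  fun _ hx => ⟨fun i => omegaCrit_subset_core hs hs2 (hx.1 i), hx.2⟩

/-- Backward orbits in `ω(c)` which stay away from the critical point are not endpoints. -/
lemma notMem_endpoints_of_mem_omegaSpace {s : ℝ} (hs : 1 < s) (hs2 : s < 2) {x : ℕ → ℝ}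
    (hx : x ∈ omegaSpace s) {η : ℝ} (hη : 0 < η) (h : ∀ n, η ≤ |x n - 1 / 2|) :
    x ∉ endpoints (space s) := by
  have hxc := omegaSpace_subset_coreSpace hs hs2.le hx
  refine notMem_endpoints hs hs2.le (coreSpace_subset_space hs hs2.le hxc)
    (η := min η (min (critOrbit s 2) (1 - critOrbit s 1))) ?_ 0 fun n _ => ?_
  · refine lt_min hη (lt_min (critOrbit_two_pos hs hs2) ?_)
    rw [critOrbit_one hs]; linarith
  · have h1 := (hxc.1 n).1
    have h2 := (hxc.1 n).2
    have h3 := min_le_right η (min (critOrbit s 2) (1 - critOrbit s 1))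
    have h4 := min_le_left (critOrbit s 2) (1 - critOrbit s 1)
    have h5 := min_le_right (critOrbit s 2) (1 - critOrbit s 1)
    exact ⟨(min_le_left _ _).trans (h n), by linarith, by linarith⟩

/-! ### Density of the non-endpoints over `ω(c)` -/

/-- Zeroth coordinates of the non-endpoints in the inverse limit of `ω(c)`. -/
def innerProj (s : ℝ) : Set ℝ :=
  (fun x : ℕ → ℝ => x 0) '' (omegaSpace s \ endpoints (space s))

lemma shift_mem_inner {s : ℝ} (hs : 1 < s) (hs2 : s ≤ 2) {x : ℕ → ℝ}
    (hx : x ∈ omegaSpace s \ endpoints (space s)) :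
    shift s x ∈ omegaSpace s \ endpoints (space s) :=
  ⟨shift_mem (fun _ h => tent_mem_omegaCrit h) hx.1, shift_notMem_endpoints hs hs2
    (coreSpace_subset_space hs hs2 (omegaSpace_subset_coreSpace hs hs2 hx.1)) hx.2⟩

lemma tent_mem_innerProj {s : ℝ} (hs : 1 < s) (hs2 : s ≤ 2) {q : ℝ} (hq : q ∈ innerProj s) :
    tent s q ∈ innerProj s := by
  obtain ⟨x, hx, rfl⟩ := hq
  exact ⟨shift s x, shift_mem_inner hs hs2 hx, rfl⟩

lemma tent_mem_closure_innerProj {s : ℝ} (hs : 1 < s) (hs2 : s ≤ 2) :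
    MapsTo (tent s) (closure (innerProj s)) (closure (innerProj s)) :=
  MapsTo.closure (fun _ h => tent_mem_innerProj hs hs2 h) (continuous_tent s)

/-- If the orbit of `c` accumulates on `c` and stays for long times close to a set `D` away
from `c`, then some backward orbit in `ω(c)` stays close to `D` until it leaves. -/
lemma exists_leaving_orbit {s : ℝ} (hs : 1 < s) (hs2 : s ≤ 2) {D : Set ℝ} (hD : D.Nonempty)
    (hDT : MapsTo (tent s) D D) (hDω : D ⊆ omegaCrit s) (hc : (1 / 2 : ℝ) ∈ omegaCrit s)
    {η : ℝ} (hη : 0 < η) (hcD : 2 * η ≤ Metric.infDist (1 / 2) D) :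
    ∃ u ∈ omegaSpace s, (∀ n, Metric.infDist (u n) D ≤ η) ∧
      η ≤ Metric.infDist (tent s (u 0)) D := by
  obtain ⟨d, hd⟩ := hD
  have hcont : Continuous fun y => Metric.infDist y D := Metric.continuous_infDist_pt D
  -- Here `e + 1 = m + j` is the first exit from the `η`-neighbourhood of `D` after a time `m ≥ 1`
  -- at which the orbit is so close to `d ∈ D` that `n + 1` consecutive points stay near `D`.
  have step : ∀ n : ℕ, ∃ e : ℕ, n + 1 ≤ e ∧ η ≤ Metric.infDist (critOrbit s (e + 1)) D ∧
      ∀ i ≤ n, Metric.infDist (critOrbit s (e - i)) D ≤ η := by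
    intro n
    have hU : {y : ℝ | ∀ i ∈ Finset.range (n + 1),
        Metric.infDist ((tent s)^[i] y) D < η} ∈ 𝓝 d := by
      have : IsOpen {y : ℝ | ∀ i ∈ Finset.range (n + 1),
          Metric.infDist ((tent s)^[i] y) D < η} := by
        simp only [ofPred_forall]
        exact isOpen_biInter_finset fun i _ =>
          isOpen_lt (hcont.comp ((continuous_tent s).iterate i)) continuous_const
      refine this.mem_nhds fun i _ => ?_
      rw [Metric.infDist_zero_of_mem (hDT.iterate i hd)]
      exact hη
    obtain ⟨m, hm1, hm⟩ := (frequently_atTop.1 (frequently_of_mem_omegaCrit (hDω hd) hU)) 1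
    have hV : {y : ℝ | η < Metric.infDist y D} ∈ 𝓝 (1 / 2 : ℝ) :=
      (isOpen_lt continuous_const hcont).mem_nhds (by simp only [mem_ofPred_eq]; linarith)
    have hex : ∃ j, η ≤ Metric.infDist (critOrbit s (m + j)) D := by
      obtain ⟨k, hk1, hk⟩ := (frequently_atTop.1 (frequently_of_mem_omegaCrit hc hV)) m
      obtain ⟨j, rfl⟩ := Nat.exists_eq_add_of_le hk1
      exact ⟨j, le_of_lt hk⟩
    classical
    set j := Nat.find hex with hj
    have hj1 := Nat.find_spec hex
    have hj2 : ∀ i < j, Metric.infDist (critOrbit s (m + i)) D < η := fun i hi =>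
      not_le.1 (Nat.find_min hex hi)
    have hjn : n < j := by
      by_contra hlt
      have := hm j (Finset.mem_range.2 (by omega))
      rw [iterate_critOrbit, add_comm] at this
      exact absurd hj1 (not_le.2 this)
    refine ⟨m + j - 1, by omega, ?_, fun i hi => ?_⟩
    · rwa [show m + j - 1 + 1 = m + j by omega]
    · rw [show m + j - 1 - i = m + (j - 1 - i) by omega]
      exact (hj2 _ (by omega)).le
  choose e he1 he2 he3 using step
  let v : ℕ → ℕ → ℝ := fun n i => critOrbit s (e n - i)
  have hcomp : IsCompact (Set.pi univ fun _ : ℕ => core s) :=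
    isCompact_univ_pi fun _ => isCompact_Icc
  -- An ultrafilter limit makes all coordinates converge at once, without extracting a diagonal
  -- subsequence.
  obtain ⟨u, -, hu⟩ := hcomp.ultrafilter_le_nhds' ((hyperfilter ℕ).map v)
    (Ultrafilter.mem_map.2 (univ_mem' fun n => fun i _ => critOrbit_mem_core hs hs2 _))
  have hlim : ∀ i, Tendsto (fun n => critOrbit s (e n - i)) (hyperfilter ℕ) (𝓝 (u i)) :=
    tendsto_pi_nhds.1 (show Tendsto v (hyperfilter ℕ) (𝓝 u) from hu)
  have hev : ∀ i : ℕ, ∀ᶠ n in (hyperfilter ℕ : Filter ℕ), i ≤ n := fun i =>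
    Nat.hyperfilter_le_atTop (eventually_ge_atTop i)
  have he : ∀ i, Tendsto (fun n => e n - i) atTop atTop := fun i =>
    tendsto_atTop_mono (fun n => Nat.sub_le_sub_right ((Nat.le_succ n).trans (he1 n)) i)
      (tendsto_sub_atTop_nat i)
  have hstep : ∀ i, Tendsto (fun n => tent s (critOrbit s (e n - i))) (hyperfilter ℕ)
      (𝓝 (tent s (u i))) := fun i => ((continuous_tent s).tendsto _).comp (hlim i)
  refine ⟨u, ⟨fun i => ?_, fun i => ?_⟩, fun i => ?_, ?_⟩
  · rw [mem_omegaCrit]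
    have h1 : MapClusterPt (u i) (hyperfilter ℕ : Filter ℕ) (critOrbit s ∘ fun n => e n - i) :=
      (hlim i).mapClusterPt
    exact MapClusterPt.of_comp ((he i).mono_left Nat.hyperfilter_le_atTop) h1
  · refine tendsto_nhds_unique ((hstep (i + 1)).congr' ?_) (hlim i)
    filter_upwards [hev (i + 1)] with n hn
    have := he1 n
    rw [← critOrbit_succ, show e n - (i + 1) + 1 = e n - i by omega]
  · refine le_of_tendsto ((hcont.tendsto _).comp (hlim i)) ?_
    filter_upwards [hev i] with n hn using he3 n i hn
  · refine ge_of_tendsto ((hcont.tendsto _).comp (hstep 0)) (Eventually.of_forall fun n => ?_)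
    simp only [Function.comp, Nat.sub_zero, ← critOrbit_succ]
    exact he2 n

/-- It suffices that `c ∈ D`, since `D` is closed and forward invariant. Otherwise the orbit leaving
`D`, with `η` half the distance from `c` to `D`, would be a non-endpoint whose next image is off
`D`. -/
lemma omegaCrit_subset_closure_innerProj {s : ℝ} (hs : 1 < s) (hs2 : s < 2)
    (hne : (omegaSpace s \ endpoints (space s)).Nonempty) (hc : (1 / 2 : ℝ) ∈ omegaCrit s) :
    omegaCrit s ⊆ closure (innerProj s) := by
  set D := closure (innerProj s) with hDdef
  have hDne : D.Nonempty := (hne.image _).closure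
  have hDT : MapsTo (tent s) D D := tent_mem_closure_innerProj hs hs2.le
  have hDω : D ⊆ omegaCrit s := closure_minimal (by
    rintro _ ⟨x, hx, rfl⟩; exact hx.1.1 0) (isClosed_omegaCrit s)
  have hDc : IsClosed D := isClosed_closure
  have hcD : (1 / 2 : ℝ) ∈ D := by
    by_contra hcD
    have hpos := (hDc.notMem_iff_infDist_pos hDne).1 hcD
    obtain ⟨u, hu, hu1, hu2⟩ := exists_leaving_orbit hs hs2.le hDne hDT hDω hc
      (half_pos hpos) (by linarith)
    have huE : u ∉ endpoints (space s) := by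
      refine notMem_endpoints_of_mem_omegaSpace hs hs2 hu (half_pos hpos) fun n => ?_
      have h1 := Metric.infDist_le_infDist_add_dist (s := D) (x := 1 / 2) (y := u n)
      rw [dist_comm, Real.dist_eq] at h1
      linarith [hu1 n]
    have h0 : tent s (u 0) ∈ D := hDT (subset_closure ⟨u, ⟨hu, huE⟩, rfl⟩)
    rw [Metric.infDist_zero_of_mem h0] at hu2
    linarith
  intro y hy
  rw [← hDc.closure_eq, mem_closure_iff_nhds]
  intro U hU
  obtain ⟨n, hn⟩ := (frequently_of_mem_omegaCrit hy hU).exists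
  exact ⟨_, hn, hDT.iterate n hcD⟩

lemma iterate_shift_apply {s : ℝ} (x : ℕ → ℝ) (M : ℕ) : (shift s)^[M] x M = x 0 := by
  induction M with
  | zero => rfl
  | succ M ih => rw [Function.iterate_succ_apply']; exact ih

/-- Approximation in a single coordinate gives approximation of backward orbits. -/
lemma mem_closure_of_forall_coord {s : ℝ} {y : ℕ → ℝ} {S : Set ℝ} (hy : y ∈ invLim (tent s) S)
    {R : Set (ℕ → ℝ)} {S' : Set ℝ} (hR : R ⊆ invLim (tent s) S')
    (h : ∀ M, y M ∈ closure ((fun x : ℕ → ℝ => x M) '' R)) : y ∈ closure R := by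
  rw [mem_closure_iff_nhds]
  intro U hU
  obtain ⟨I, t, ht, htU⟩ := Filter.mem_pi'.1 (nhds_pi (a := y) ▸ hU)
  -- A basic neighbourhood constrains finitely many coordinates, all of which are continuous
  -- functions of the `M`-th one.
  set M := I.sup id
  have hle : ∀ i ∈ I, i ≤ M := fun i hi => Finset.le_sup (f := id) hi
  have hV : {q : ℝ | ∀ i ∈ I, (tent s)^[M - i] q ∈ t i} ∈ 𝓝 (y M) := by
    simp only [ofPred_forall]
    rw [biInter_finset_mem]
    intro i hi
    refine ((continuous_tent s).iterate (M - i)).continuousAt ?_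
    rw [invLim_iterate_of_le hy (hle i hi)]
    exact ht i
  obtain ⟨_, hq, x, hx, rfl⟩ := mem_closure_iff_nhds.1 (h M) _ hV
  refine ⟨x, htU fun i hi => ?_, hx⟩
  rw [← invLim_iterate_of_le (hR hx) (hle i hi)]
  exact hq i hi

theorem omegaSpace_subset_closure {s : ℝ} (hs : 1 < s) (hs2 : s < 2)
    (hne : (omegaSpace s \ endpoints (space s)).Nonempty) :
    omegaSpace s ⊆ closure (omegaSpace s \ endpoints (space s)) := by
  intro y hy
  by_cases hc : (1 / 2 : ℝ) ∈ omegaCrit s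
  · refine mem_closure_of_forall_coord hy sdiff_subset fun M => ?_
    refine closure_mono ?_ (omegaCrit_subset_closure_innerProj hs hs2 hne hc (hy.1 M))
    rintro _ ⟨x, hx, rfl⟩
    exact ⟨(shift s)^[M] x, MapsTo.iterate (fun _ h => shift_mem_inner hs hs2.le h) M hx,
      iterate_shift_apply x M⟩
  · refine subset_closure ⟨hy, ?_⟩
    have hpos := ((isClosed_omegaCrit s).notMem_iff_infDist_pos ⟨_, hy.1 0⟩).1 hc
    refine notMem_endpoints_of_mem_omegaSpace hs hs2 hy hpos fun n => ?_
    rw [← Real.dist_eq, dist_comm]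
    exact Metric.infDist_le_dist_of_mem (hy.1 n)

/-! ### Backward orbits in `ω(c)` are folding points -/

lemma subset_or_subset_of_max {P Q : Set ℝ} (hP : IsPreconnected P) (hQ : IsPreconnected Q) {m : ℝ}
    (hmP : m ∈ P) (hmQ : m ∈ Q) (hPm : ∀ p ∈ P, p ≤ m) (hQm : ∀ q ∈ Q, q ≤ m) :
    P ⊆ Q ∨ Q ⊆ P := by
  by_contra! h
  obtain ⟨⟨p, hp, hpQ⟩, ⟨q, hq, hqP⟩⟩ := And.imp not_subset.1 not_subset.1 h
  rcases le_total p q with hpq | hpq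
  · exact hqP (hP.ordConnected.out hp hmP ⟨hpq, hQm q hq⟩)
  · exact hpQ (hQ.ordConnected.out hq hmQ ⟨hpq, hPm p hp⟩)

/-- Connected sets through a point with a critical coordinate have nested projections. -/
lemma image_subset_or_of_crit {s : ℝ} (hs : 1 < s) {S : Set ℝ} {C D : Set (ℕ → ℝ)}
    (hC : C ⊆ invLim (tent s) S) (hD : D ⊆ invLim (tent s) S) (hCc : IsPreconnected C)
    (hDc : IsPreconnected D) {z : ℕ → ℝ} (hzC : z ∈ C) (hzD : z ∈ D) {N j : ℕ}
    (hNj : N ≤ j) (hz : z (j + 1) = 1 / 2) :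
    (fun x : ℕ → ℝ => x N) '' C ⊆ (fun x : ℕ → ℝ => x N) '' D ∨
      (fun x : ℕ → ℝ => x N) '' D ⊆ (fun x : ℕ → ℝ => x N) '' C := by
  have hproj : ∀ {C : Set (ℕ → ℝ)}, C ⊆ invLim (tent s) S →
      (fun x : ℕ → ℝ => x N) '' C = (tent s)^[j - N] '' ((fun x : ℕ → ℝ => x j) '' C) := by
    intro C hC
    rw [image_image]
    exact image_congr fun x hx => (invLim_iterate_of_le (hC hx) hNj).symm
  have hmax : ∀ {C : Set (ℕ → ℝ)}, C ⊆ invLim (tent s) S →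
      ∀ p ∈ (fun x : ℕ → ℝ => x j) '' C, p ≤ critOrbit s 1 := by
    rintro C hC _ ⟨x, hx, rfl⟩
    have := tent_le hs (x (j + 1))
    rwa [(hC hx).2 j] at this
  have hzj : z j = critOrbit s 1 := by
    rw [← (hC hzC).2 j, hz, critOrbit_succ, critOrbit_zero]
  rw [hproj hC, hproj hD]
  refine (subset_or_subset_of_max (m := critOrbit s 1)
    (hCc.image _ (continuous_apply j).continuousOn)
    (hDc.image _ (continuous_apply j).continuousOn) ⟨z, hzC, hzj⟩ ⟨z, hzD, hzj⟩
    (hmax hC) (hmax hD)).imp (fun h => image_mono h) fun h => image_mono h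

/-- Near a backward orbit in `ω(c)` there are backward orbits with critical coordinates. -/
lemma exists_tendsto_crit {s : ℝ} (hs : 1 < s) (hs2 : s ≤ 2) {x : ℕ → ℝ} (hx : x ∈ omegaSpace s) :
    ∃ z : ℕ → ℕ → ℝ, Tendsto z atTop (𝓝[coreSpace s] x) ∧
      ∀ n, ∃ j, n ≤ j ∧ z n (j + 1) = 1 / 2 := by
  -- The tolerance absorbs the expansion `s ^ n` and leaves `1 / (n + 1)`. Placing `c` at position
  -- `n + m` puts `c_m` at position `n`; `1 ≤ m` ensures `n + m - 1 ≥ n`.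
  have h1 : ∀ n : ℕ, ∃ m, 1 ≤ m ∧ |critOrbit s m - x n| < 1 / (s ^ n * (n + 1)) := fun n => by
    obtain ⟨m, hm, hm'⟩ := (frequently_atTop.1 (frequently_of_mem_omegaCrit (hx.1 n)
      (Metric.ball_mem_nhds (x n) (ε := 1 / (s ^ n * (n + 1))) (by positivity)))) 1
    exact ⟨m, hm, by simpa [Real.dist_eq] using hm'⟩
  choose m hm1 hm using h1
  refine ⟨fun n => coreLift s (n + m n) (1 / 2), ?_, fun n => ⟨n + m n - 1, ?_, ?_⟩⟩
  · refine tendsto_nhdsWithin_iff.2 ⟨?_, Eventually.of_forall fun n =>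
      coreLift_mem hs hs2 (crit_mem_core hs) _⟩
    refine tendsto_pi_nhds.2 fun i => ?_
    rw [tendsto_iff_dist_tendsto_zero]
    refine squeeze_zero' (Eventually.of_forall fun _ => dist_nonneg) ?_
      tendsto_one_div_add_atTop_nhds_zero_nat
    filter_upwards [eventually_ge_atTop i] with n hn
    rw [Real.dist_eq, coreLift_of_le (by omega), ← invLim_iterate_of_le hx hn,
      show n + m n - i = (n - i) + m n by omega, Function.iterate_add_apply]
    refine (abs_iterate_tent_sub_le hs _ _ _).trans ?_
    have h2 : s ^ (n - i) ≤ s ^ n := pow_le_pow_right₀ hs.le (Nat.sub_le n i)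
    calc s ^ (n - i) * |(tent s)^[m n] (1 / 2) - x n|
        ≤ s ^ n * (1 / (s ^ n * (n + 1))) := by
          gcongr
          exact (hm n).le
      _ = 1 / ((n : ℝ) + 1) := by field_simp
  · have := hm1 n; omega
  · have := hm1 n
    rw [show n + m n - 1 + 1 = n + m n by omega]
    exact coreLift_self _

/-- A neighbourhood homeomorphic to the product of a Cantor set and an open arc, written with
closed arcs parametrized by real numbers. -/
lemma HasCantorArcNhd.exists_chart {E : Type*} [TopologicalSpace E] {Y : Set E} {x : E}
    (hxY : x ∈ Y) (h : HasCantorArcNhd Y x) :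
    ∃ (K : Set (ℕ → ℝ)) (g : K × ℝ → E) (a b t : ℝ) (k : K) (f : E → K × ℝ),
      a < t ∧ t < b ∧ Continuous g ∧ (∀ q, g q ∈ Y) ∧
      (∀ r r', r ∈ Icc a b → r' ∈ Icc a b → g (k, r) = g (k, r') → r = r') ∧
      Tendsto f (𝓝[Y] x) (𝓝 (k, t)) ∧ ∀ᶠ z in 𝓝[Y] x, g (f z) = z := by
  obtain ⟨U, hUY, hU, K, -, ⟨h⟩⟩ := h
  have hxU : x ∈ U := mem_of_mem_nhdsWithin hxY hU
  obtain ⟨⟨k, ⟨t, ht⟩⟩, hkt⟩ : ∃ q, h ⟨x, hxU⟩ = q := ⟨_, rfl⟩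
  have hab : t / 2 ≤ (t + 1) / 2 := by linarith
  -- Clamping to this closed arc around `t` with `projIcc` lets `g` accept every real parameter.
  have hsub : Icc (t / 2) ((t + 1) / 2) ⊆ Ioo (0 : ℝ) 1 := fun r hr =>
    ⟨by linarith [hr.1, ht.1], by linarith [hr.2, ht.2]⟩
  let c : ℝ → Ioo (0 : ℝ) 1 := fun r => inclusion hsub (projIcc _ _ hab r)
  have hc : Continuous c := (continuous_inclusion hsub).comp continuous_projIcc
  have hcr : ∀ r ∈ Icc (t / 2) ((t + 1) / 2), (c r : ℝ) = r := fun r hr => by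
    simp only [c, projIcc_of_mem hab hr]
  classical
  let f : E → K × ℝ := fun z =>
    if hz : z ∈ U then ((h ⟨z, hz⟩).1, ((h ⟨z, hz⟩).2 : ℝ)) else (k, t)
  have hf : Tendsto f (𝓝[Y] x) (𝓝 (k, t)) := by
    have h1 : ContinuousOn f U := by
      rw [continuousOn_iff_continuous_domRestrict]
      have : U.domRestrict f = fun z => ((h z).1, ((h z).2 : ℝ)) := by
        funext z; simp [f]
      rw [this]
      fun_prop
    have h2 : f x = (k, t) := by simp [f, hxU, hkt]
    have h3 : 𝓝[Y] x ≤ 𝓝[U] x := by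
      rw [nhdsWithin, nhdsWithin]
      exact le_inf inf_le_left (le_principal_iff.2 hU)
    rw [← h2]
    exact (h1 x hxU).mono_left h3
  refine ⟨K, fun q => h.symm (q.1, c q.2), t / 2, (t + 1) / 2, t, k, f, by linarith [ht.1],
    by linarith [ht.2], by fun_prop, fun q => hUY (h.symm _).2, ?_, hf, ?_⟩
  · intro r r' hr hr' he
    have h1 := h.symm.injective (Subtype.ext he)
    have h2 : c r = c r' := (Prod.ext_iff.1 h1).2
    rw [← hcr r hr, ← hcr r' hr', h2]
  · have hI : ∀ᶠ z in 𝓝[Y] x, (f z).2 ∈ Icc (t / 2) ((t + 1) / 2) :=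
      (continuous_snd.tendsto _).comp hf |>.eventually
        (Icc_mem_nhds (by linarith [ht.1]) (by linarith [ht.2]))
    filter_upwards [hU, hI] with z hz hzI
    have h1 : c (f z).2 = (h ⟨z, hz⟩).2 := Subtype.ext (by rw [hcr _ hzI]; simp [f, hz])
    have h2 : (f z).1 = (h ⟨z, hz⟩).1 := by simp [f, hz]
    simp only [h1, h2, Prod.mk.eta, Homeomorph.symm_apply_apply]

/-- Chart arcs through the approximating points `z n` fold in coordinate `n`; in the limit the chart
would fail to be injective on the arc through `x`. -/
theorem omegaSpace_subset_foldingPoints {s : ℝ} (hs : 1 < s) (hs2 : s ≤ 2) :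
    omegaSpace s ⊆ foldingPoints s := by
  intro x hx
  have hxc := omegaSpace_subset_coreSpace hs hs2 hx
  refine ⟨hxc, fun h => ?_⟩
  obtain ⟨K, g, a, b, t, k, f, hat, htb, hg, hgY, hinj, hf, hgf⟩ := h.exists_chart hxc
  obtain ⟨z, hz, hzc⟩ := exists_tendsto_crit hs hs2 hx
  have hfz := hf.comp hz
  have hk : Tendsto (fun n => (f (z n)).1) atTop (𝓝 k) := (continuous_fst.tendsto _).comp hfz
  have ht : Tendsto (fun n => (f (z n)).2) atTop (𝓝 t) := (continuous_snd.tendsto _).comp hfz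
  -- One end of the arc through `z n` shares its `n`-th coordinate with a parameter on the other
  -- side of `z n`.
  have hev : ∀ᶠ n in atTop,
      (∃ r ∈ Icc a b, (f (z n)).2 ≤ r ∧ g ((f (z n)).1, r) n = g ((f (z n)).1, a) n) ∨
      (∃ r ∈ Icc a b, r ≤ (f (z n)).2 ∧ g ((f (z n)).1, r) n = g ((f (z n)).1, b) n) := by
    filter_upwards [hz.eventually hgf, ht.eventually (Icc_mem_nhds hat htb)] with n hn hn'
    obtain ⟨j, hj, hj'⟩ := hzc n
    set κ := (f (z n)).1
    set τ := (f (z n)).2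
    have hgκ : Continuous fun r => g (κ, r) := by fun_prop
    have hsub : ∀ I : Set ℝ, (fun r => g (κ, r)) '' I ⊆ coreSpace s := by
      rintro I _ ⟨r, -, rfl⟩; exact hgY _
    rcases image_subset_or_of_crit hs (hsub (Icc a τ)) (hsub (Icc τ b))
      (isPreconnected_Icc.image _ hgκ.continuousOn) (isPreconnected_Icc.image _ hgκ.continuousOn)
      (z := z n) ⟨τ, ⟨hn'.1, le_rfl⟩, hn⟩ ⟨τ, ⟨le_rfl, hn'.2⟩, hn⟩ hj hj' with h | h
    · obtain ⟨_, ⟨r, hr, rfl⟩, hr'⟩ := h ⟨_, ⟨a, ⟨le_rfl, hn'.1⟩, rfl⟩, rfl⟩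
      exact Or.inl ⟨r, ⟨hn'.1.trans hr.1, hr.2⟩, hr.1, hr'⟩
    · obtain ⟨_, ⟨r, hr, rfl⟩, hr'⟩ := h ⟨_, ⟨b, ⟨hn'.2, le_rfl⟩, rfl⟩, rfl⟩
      exact Or.inr ⟨r, ⟨hr.1, hr.2.trans hn'.2⟩, hr.2, hr'⟩
  have hU := Nat.hyperfilter_le_atTop
  -- Agreement in coordinate `n` forces agreement in all coordinates `i ≤ n`, so limits of the
  -- parameters give equal points of `X'`.
  have limit : ∀ d : ℝ, ∀ R : ℝ → ℝ → Prop, IsClosed {q : ℝ × ℝ | R q.1 q.2} →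
      (∀ᶠ n in (hyperfilter ℕ : Filter ℕ), ∃ r ∈ Icc a b, R r (f (z n)).2 ∧
        g ((f (z n)).1, r) n = g ((f (z n)).1, d) n) →
      ∃ r ∈ Icc a b, R r t ∧ g (k, r) = g (k, d) := by
    intro d R hR hd
    have hd' : ∀ n, ∃ r ∈ Icc a b, (∃ r ∈ Icc a b, R r (f (z n)).2 ∧
        g ((f (z n)).1, r) n = g ((f (z n)).1, d) n) → (R r (f (z n)).2 ∧
        g ((f (z n)).1, r) n = g ((f (z n)).1, d) n) := fun n => by
      by_cases hn : ∃ r ∈ Icc a b, R r (f (z n)).2 ∧ g ((f (z n)).1, r) n = g ((f (z n)).1, d) n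
      · obtain ⟨r, hr, hr'⟩ := hn
        exact ⟨r, hr, fun _ => hr'⟩
      · exact ⟨a, ⟨le_rfl, (hat.trans htb).le⟩, fun h => absurd h hn⟩
    choose r hrI hr using hd'
    obtain ⟨r₀, hr₀, hlim⟩ := (isCompact_Icc (a := a) (b := b)).ultrafilter_le_nhds'
      ((hyperfilter ℕ).map r) (Ultrafilter.mem_map.2 (univ_mem' hrI))
    have hlim' : Tendsto r (hyperfilter ℕ) (𝓝 r₀) := hlim
    have hk' := hk.mono_left hU
    have ht' := ht.mono_left hU
    refine ⟨r₀, hr₀, hR.mem_of_tendsto (hlim'.prodMk_nhds ht') ?_, funext fun i => ?_⟩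
    · filter_upwards [hd] with n hn using (hr n hn).1
    · have hgi : Continuous fun q => g q i := (continuous_apply i).comp hg
      refine tendsto_nhds_unique_of_eventuallyEq
        ((hgi.tendsto (k, r₀)).comp (hk'.prodMk_nhds hlim'))
        ((hgi.tendsto (k, d)).comp (hk'.prodMk_nhds tendsto_const_nhds)) ?_
      filter_upwards [hd, hU (eventually_ge_atTop i)] with n hn hni
      simp only [Function.comp]
      rw [← invLim_iterate_of_le (hgY _) hni, (hr n hn).2, invLim_iterate_of_le (hgY _) hni]
  rcases Ultrafilter.eventually_or.1 (hU hev) with h | h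
  · obtain ⟨r, hr, htr, he⟩ := limit a (fun r t => t ≤ r)
      (isClosed_le continuous_snd continuous_fst) h
    have := hinj r a hr ⟨le_rfl, (hat.trans htb).le⟩ he
    linarith
  · obtain ⟨r, hr, htr, he⟩ := limit b (fun r t => r ≤ t)
      (isClosed_le continuous_fst continuous_snd) h
    have := hinj r b hr ⟨(hat.trans htb).le, le_rfl⟩ he
    linarith

/-! ### Product structure away from the critical orbit -/

lemma ne_critOrbit {s : ℝ} {I : Set ℝ} (hI : ∀ k, critOrbit s k ∉ I) {n k : ℕ} {u : ℝ}
    (hu : (tent s)^[n] u ∈ I) : u ≠ critOrbit s k := by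
  rintro rfl
  rw [iterate_critOrbit] at hu
  exact hI _ hu

/-- The backward orbit of `t` which follows the branches of `y` beyond position `N`. -/
def follow (s : ℝ) (N : ℕ) (y : ℕ → ℝ) (t : ℝ) : ℕ → ℝ
  | 0 => t
  | l + 1 => if y (N + l + 1) ≤ 1 / 2 then follow s N y t l / s else 1 - follow s N y t l / s

/-- The backward orbit with coordinate `t` at position `N` following the branches of `y`. -/
def slide (s : ℝ) (N : ℕ) (y : ℕ → ℝ) (t : ℝ) : ℕ → ℝ :=
  fun i => (tent s)^[N - i] (follow s N y t (i - N))

lemma slide_add (s : ℝ) (N : ℕ) (y : ℕ → ℝ) (t : ℝ) (l : ℕ) :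
    slide s N y t (N + l) = follow s N y t l := by
  simp [slide]

lemma slide_apply_self (s : ℝ) (N : ℕ) (y : ℕ → ℝ) (t : ℝ) : slide s N y t N = t :=
  slide_add s N y t 0

lemma continuous_follow (s : ℝ) (N : ℕ) (y : ℕ → ℝ) (l : ℕ) :
    Continuous fun t => follow s N y t l := by
  induction l with
  | zero => exact continuous_id
  | succ l ih =>
    by_cases h : y (N + l + 1) ≤ 1 / 2
    · simp only [follow, if_pos h]; fun_prop
    · simp only [follow, if_neg h]; fun_prop

lemma follow_self {s : ℝ} (hs : 1 < s) {S : Set ℝ} {y : ℕ → ℝ} (hy : y ∈ invLim (tent s) S)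
    (N l : ℕ) : follow s N y (y N) l = y (N + l) := by
  have hs0 : s ≠ 0 := by linarith
  induction l with
  | zero => rfl
  | succ l ih =>
    have h := hy.2 (N + l)
    simp only [follow, ih]
    split_ifs with hc
    · rw [tent_of_le hs hc] at h
      rw [← h, ← Nat.add_assoc]; field_simp
    · rw [tent_of_ge hs (by linarith)] at h
      rw [← h, ← Nat.add_assoc]; field_simp; ring

lemma slide_self {s : ℝ} (hs : 1 < s) {S : Set ℝ} {y : ℕ → ℝ} (hy : y ∈ invLim (tent s) S)
    (N : ℕ) : slide s N y (y N) = y := by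
  funext i
  simp only [slide, follow_self hs hy]
  rcases le_total N i with h | h
  · rw [Nat.sub_eq_zero_of_le h, Nat.add_sub_cancel' h]; rfl
  · rw [Nat.sub_eq_zero_of_le h, Nat.add_zero, invLim_iterate_of_le hy h]

section Box

variable {s : ℝ} {N : ℕ} {I : Set ℝ} {y : ℕ → ℝ} {t : ℝ}

lemma follow_branch {l : ℕ} (hs : 1 < s) (h : follow s N y t l < critOrbit s 1) :
    tent s (follow s N y t (l + 1)) = follow s N y t l ∧
      (follow s N y t (l + 1) ≤ 1 / 2 ↔ y (N + l + 1) ≤ 1 / 2) := by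
  rw [critOrbit_one hs] at h
  have hlt : follow s N y t l / s < 1 / 2 := by rw [div_lt_iff₀ (by linarith)]; linarith
  by_cases hc : y (N + l + 1) ≤ 1 / 2
  · simp only [follow, if_pos hc]
    refine ⟨?_, iff_of_true hlt.le hc⟩
    rw [tent_of_le hs hlt.le]; field_simp
  · simp only [follow, if_neg hc]
    refine ⟨?_, iff_of_false (by linarith) hc⟩
    rw [tent_of_ge hs (by linarith)]; field_simp; ring

/-- By induction, the branch image of `I` is an interval meeting the core. It avoids the critical
orbit, because `T^l` returns it to `I`; so it never reaches `c_2` or `c_1`, and the branches can be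
continued. -/
lemma follow_spec (hs : 1 < s) (hIc : IsPreconnected I)
    (hI : ∀ k, critOrbit s k ∉ I) (hy : y ∈ coreSpace s) (hyI : y N ∈ I) (l : ℕ) (ht : t ∈ I) :
    follow s N y t l ∈ Ioo (critOrbit s 2) (critOrbit s 1) ∧
      (tent s)^[l] (follow s N y t l) = t ∧
      tent s (follow s N y t (l + 1)) = follow s N y t l ∧
      (follow s N y t (l + 1) ≤ 1 / 2 ↔ y (N + l + 1) ≤ 1 / 2) := by
  have main : ∀ t ∈ I, follow s N y t l ∈ Ioo (critOrbit s 2) (critOrbit s 1) ∧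
      (tent s)^[l] (follow s N y t l) = t := by
    clear ht
    induction l with
    | zero =>
      intro t ht
      refine ⟨?_, rfl⟩
      have hord := hIc.ordConnected
      have hyc := hy.1 N
      simp only [follow]
      constructor
      · by_contra! h
        exact hI 2 (hord.out ht hyI ⟨h, hyc.1⟩)
      · by_contra! h
        exact hI 1 (hord.out hyI ht ⟨hyc.2, h⟩)
    | succ l ih =>
      have hT : ∀ t ∈ I, (tent s)^[l + 1] (follow s N y t (l + 1)) = t := fun t ht => by
        obtain ⟨h1, h2⟩ := ih t ht
        rw [Function.iterate_succ_apply, (follow_branch hs h1.2).1, h2]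
      have hord := (hIc.image _ (continuous_follow s N y (l + 1)).continuousOn).ordConnected
      have hav : ∀ k, critOrbit s k ∉ (fun t => follow s N y t (l + 1)) '' I := by
        rintro k ⟨t, ht, he⟩
        exact ne_critOrbit hI (n := l + 1) (by rw [hT t ht]; exact ht) he
      have hyc := hy.1 (N + (l + 1))
      rw [← follow_self hs hy] at hyc
      intro t ht
      refine ⟨⟨?_, ?_⟩, hT t ht⟩
      · by_contra! h
        exact hav 2 (hord.out ⟨t, ht, rfl⟩ ⟨_, hyI, rfl⟩ ⟨h, hyc.1⟩)
      · by_contra! h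
        exact hav 1 (hord.out ⟨_, hyI, rfl⟩ ⟨t, ht, rfl⟩ ⟨hyc.2, h⟩)
  obtain ⟨h1, h2⟩ := main t ht
  exact ⟨h1, h2, follow_branch hs h1.2⟩

lemma slide_mem (hs : 1 < s) (hs2 : s ≤ 2) (hIc : IsPreconnected I)
    (hI : ∀ k, critOrbit s k ∉ I) (hy : y ∈ coreSpace s) (hyI : y N ∈ I) (ht : t ∈ I) :
    slide s N y t ∈ coreSpace s :=
  extend_mem_invLim (fun _ hx => tent_mem_core hs hs2 hx) N
    ⟨fun l => Ioo_subset_Icc_self (follow_spec hs hIc hI hy hyI l ht).1,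
      fun l => (follow_spec hs hIc hI hy hyI l ht).2.2.1⟩

lemma slide_slide (hs : 1 < s) (hIc : IsPreconnected I)
    (hI : ∀ k, critOrbit s k ∉ I) (hy : y ∈ coreSpace s) (hyI : y N ∈ I) (ht : t ∈ I) (t' : ℝ) :
    slide s N (slide s N y t) t' = slide s N y t' := by
  have h : ∀ l, follow s N (slide s N y t) t' l = follow s N y t' l := fun l => by
    induction l with
    | zero => rfl
    | succ l ih =>
      simp only [follow, ih]
      have h1 := (follow_spec hs hIc hI hy hyI l ht).2.2.2
      rw [← slide_add, ← Nat.add_assoc] at h1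
      simp only [h1]
  funext i
  simp only [slide] at h ⊢
  rw [h]

lemma apply_ne_half (hI : ∀ k, critOrbit s k ∉ I) (hy : y ∈ coreSpace s) (hyI : y N ∈ I) (l : ℕ) :
    y (N + l) ≠ 1 / 2 := by
  rw [← critOrbit_zero s]
  exact ne_critOrbit hI (n := l) (by rw [invLim_iterate hy]; exact hyI)

/-- The part of the core inverse limit with coordinate in `I` at position `N`. -/
def box (s : ℝ) (N : ℕ) (I : Set ℝ) : Set (ℕ → ℝ) := {y ∈ coreSpace s | y N ∈ I}

/-- The branch choice is locally constant in `y`, since no coordinate of `y` beyond `N` equals `c`.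
-/
lemma continuous_slide (hI : ∀ k, critOrbit s k ∉ I) :
    Continuous fun q : box s N I × ℝ => slide s N q.1 q.2 := by
  have h : ∀ l, Continuous fun q : box s N I × ℝ => follow s N q.1 q.2 l := fun l => by
    induction l with
    | zero => exact continuous_snd
    | succ l ih =>
      simp only [follow]
      have hc : Continuous fun q : box s N I × ℝ => (q.1 : ℕ → ℝ) (N + l + 1) :=
        (continuous_apply _).comp (continuous_subtype_val.comp continuous_fst)
      refine Continuous.if_le (ih.div_const s) (continuous_const.sub (ih.div_const s)) hc
        continuous_const fun q hq => ?_
      exact absurd hq (apply_ne_half hI q.1.2.1 q.1.2.2 (l + 1))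
  exact continuous_pi fun i => ((continuous_tent s).iterate _).comp (h _)

end Box

/-- Over an open interval free of the critical orbit the core inverse limit is a product. -/
def boxHomeomorph {s : ℝ} (hs : 1 < s) (hs2 : s ≤ 2) (N : ℕ) {p δ : ℝ} (hδ : 0 < δ)
    (hI : ∀ k, critOrbit s k ∉ Ioo (p - δ) (p + δ)) :
    box s N (Ioo (p - δ) (p + δ)) ≃ₜ ({y ∈ coreSpace s | y N = p} : Set (ℕ → ℝ)) ×
      Ioo (0 : ℝ) 1 where
  toFun y := (⟨slide s N y p, slide_mem hs hs2 isPreconnected_Ioo hI y.2.1 y.2.2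
      ⟨by linarith, by linarith⟩, slide_apply_self _ _ _ _⟩,
    ⟨((y : ℕ → ℝ) N - (p - δ)) / (2 * δ), div_pos (by linarith [y.2.2.1]) (by linarith),
      by rw [div_lt_one (by linarith)]; linarith [y.2.2.2]⟩)
  invFun q :=
    have ht : p - δ + 2 * δ * (q.2 : ℝ) ∈ Ioo (p - δ) (p + δ) :=
      ⟨by nlinarith [q.2.2.1], by nlinarith [q.2.2.2]⟩
    ⟨slide s N q.1 (p - δ + 2 * δ * q.2), slide_mem hs hs2 isPreconnected_Ioo hI q.1.2.1
      (by rw [q.1.2.2]; exact ⟨by linarith, by linarith⟩) ht,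
      by rw [slide_apply_self]; exact ht⟩
  left_inv y := by
    apply Subtype.ext
    simp only
    rw [slide_slide hs isPreconnected_Ioo hI y.2.1 y.2.2 ⟨by linarith, by linarith⟩]
    rw [show p - δ + 2 * δ * (((y : ℕ → ℝ) N - (p - δ)) / (2 * δ)) = (y : ℕ → ℝ) N by
      field_simp; ring]
    exact slide_self hs y.2.1 N
  right_inv q := by
    have hq : (q.1 : ℕ → ℝ) N ∈ Ioo (p - δ) (p + δ) := by
      rw [q.1.2.2]; exact ⟨by linarith, by linarith⟩
    have ht : p - δ + 2 * δ * (q.2 : ℝ) ∈ Ioo (p - δ) (p + δ) :=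
      ⟨by nlinarith [q.2.2.1], by nlinarith [q.2.2.2]⟩
    refine Prod.ext (Subtype.ext ?_) (Subtype.ext ?_)
    · simp only
      rw [slide_slide hs isPreconnected_Ioo hI q.1.2.1 hq ht]
      have := slide_self hs q.1.2.1 N
      rwa [q.1.2.2] at this
    · simp only [slide_apply_self]
      field_simp; ring
  continuous_toFun := by
    refine Continuous.prodMk (Continuous.subtype_mk ?_ _) (Continuous.subtype_mk ?_ _)
    · exact (continuous_slide hI).comp (continuous_id.prodMk continuous_const)
    · exact (((continuous_apply N).comp continuous_subtype_val).sub continuous_const).div_const _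
  continuous_invFun := by
    refine Continuous.subtype_mk ?_ _
    have h1 : Continuous fun q : ({y ∈ coreSpace s | y N = p} : Set (ℕ → ℝ)) × Ioo (0 : ℝ) 1 =>
        ((⟨q.1, q.1.2.1, by rw [q.1.2.2]; exact ⟨by linarith, by linarith⟩⟩ :
          box s N (Ioo (p - δ) (p + δ))), p - δ + 2 * δ * (q.2 : ℝ)) := by fun_prop
    exact (continuous_slide hI).comp h1

/-! ### Cantor fibres -/

lemma isCompact_coreSpace (s : ℝ) : IsCompact (coreSpace s) := by
  have h : coreSpace s = (Set.pi univ fun _ : ℕ => core s) ∩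
      ⋂ i, {x : ℕ → ℝ | tent s (x (i + 1)) = x i} := by
    ext x; simp only [coreSpace, invLim, mem_ofPred_eq, mem_inter_iff, mem_univ_pi, mem_iInter]
  rw [h]
  refine (isCompact_univ_pi fun _ => isCompact_Icc).inter_right (isClosed_iInter fun i => ?_)
  exact isClosed_eq ((continuous_tent s).comp (continuous_apply _)) (continuous_apply _)

lemma finite_preimage_iterate {s : ℝ} (hs : 1 < s) (n : ℕ) (q : ℝ) :
    {u | (tent s)^[n] u = q}.Finite := by
  have hs0 : s ≠ 0 := by linarith
  induction n generalizing q with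
  | zero => simp
  | succ n ih =>
    refine Finite.subset ((ih q).biUnion (t := fun v => {v / s, 1 - v / s})
      fun v _ => toFinite _) fun u hu => ?_
    simp only [mem_ofPred_eq, Function.iterate_succ_apply] at hu
    refine mem_biUnion hu ?_
    rcases le_total u (1 / 2) with h | h
    · left; rw [tent_of_le hs h]; field_simp
    · right; rw [mem_singleton_iff, tent_of_ge hs h]; field_simp; ring

/-- On the fibre every coordinate takes finitely many values. -/
lemma isTotallyDisconnected_fibre {s : ℝ} (hs : 1 < s) (N : ℕ) (p : ℝ) :
    IsTotallyDisconnected {y ∈ coreSpace s | y N = p} := by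
  intro t ht htc x hx y hy
  funext i
  have hfin : ((fun z : ℕ → ℝ => z i) '' t).Finite := by
    rcases le_total i N with h | h
    · refine (finite_singleton ((tent s)^[N - i] p)).subset ?_
      rintro _ ⟨z, hz, rfl⟩
      rw [mem_singleton_iff, ← (ht hz).2, invLim_iterate_of_le (ht hz).1 h]
    · refine (finite_preimage_iterate hs (i - N) p).subset ?_
      rintro _ ⟨z, hz, rfl⟩
      rw [mem_ofPred_eq, invLim_iterate_of_le (ht hz).1 h, (ht hz).2]
  exact hfin.countable.isTotallyDisconnected _ Subset.rfl
    (htc.image _ (continuous_apply i).continuousOn) ⟨x, hx, rfl⟩ ⟨y, hy, rfl⟩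

/-- The fixed point of the tent map in `[c, 1]`. -/
def fixedPt (s : ℝ) : ℝ := s / (1 + s)

lemma abs_rightInv_sub_fixedPt {s : ℝ} (hs : 1 < s) (u : ℝ) :
    |rightInv s u - fixedPt s| = |u - fixedPt s| / s := by
  have h : rightInv s u - fixedPt s = -(u - fixedPt s) / s := by
    unfold rightInv fixedPt; field_simp; ring
  rw [h, abs_div, abs_neg, abs_of_pos (a := s) (by linarith)]

lemma tendsto_iterate_rightInv {s : ℝ} (hs : 1 < s) (u : ℝ) :
    Tendsto (fun n => (rightInv s)^[n] u) atTop (𝓝 (fixedPt s)) := by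
  have h : ∀ n, dist ((rightInv s)^[n] u) (fixedPt s) = |u - fixedPt s| * (s⁻¹) ^ n := fun n => by
    induction n with
    | zero => simp [Real.dist_eq]
    | succ n ih =>
      rw [Real.dist_eq] at ih ⊢
      rw [Function.iterate_succ_apply', abs_rightInv_sub_fixedPt hs, ih, pow_succ]
      field_simp
  rw [tendsto_iff_dist_tendsto_zero]
  simp only [h]
  simpa using (tendsto_pow_atTop_nhds_zero_of_lt_one (inv_nonneg.2 (by linarith))
    (inv_lt_one_of_one_lt₀ hs)).const_mul |u - fixedPt s|

/-- Points of the core below `c_3` have only the right preimage in the core. -/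
lemma eq_rightInv {s : ℝ} (hs : 1 < s) {u : ℝ} (hu : u ∈ core s)
    (h : tent s u < critOrbit s 3) : u = rightInv s (tent s u) := by
  rcases le_total u (1 / 2) with hc | hc
  · rw [tent_of_le hs hc, critOrbit_three hs] at h
    nlinarith [hu.1]
  · rw [tent_of_ge hs hc, rightInv]; field_simp; ring

lemma eq_iterate_rightInv {s : ℝ} (hs : 1 < s) {x : ℕ → ℝ} (hx : x ∈ coreSpace s) (N l : ℕ)
    (h : ∀ i < l, x (N + i) < critOrbit s 3) : x (N + l) = (rightInv s)^[l] (x N) := by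
  induction l with
  | zero => rfl
  | succ l ih =>
    have h1 := h l (by omega)
    rw [← hx.2 (N + l)] at h1
    rw [Function.iterate_succ_apply', ← ih fun i hi => h i (by omega), ← Nat.add_assoc,
      eq_rightInv hs (hx.1 _) h1, hx.2]

/-- After clearing denominators the difference is a positive multiple of `(s - 1) * (s ^ 2 - 2)`,
whence the threshold `s ^ 2 = 2`. -/
lemma critOrbit_three_lt_fixedPt {s : ℝ} (hs : 1 < s) (h2 : 2 < s ^ 2) :
    critOrbit s 3 < fixedPt s := by
  rw [critOrbit_three hs, critOrbit_two hs, fixedPt, lt_div_iff₀ (by linarith)]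
  have h3 : 0 < (s - 1) * (s ^ 2 - 2) := mul_pos (by linarith) (by linarith)
  nlinarith

lemma fixedPt_lt_critOrbit_three {s : ℝ} (hs : 1 < s) (h2 : s ^ 2 < 2) :
    fixedPt s < critOrbit s 3 := by
  rw [critOrbit_three hs, critOrbit_two hs, fixedPt, div_lt_iff₀ (by linarith)]
  have h3 : 0 < (s - 1) * (2 - s ^ 2) := mul_pos (by linarith) (by linarith)
  nlinarith

/-- A backward orbit staying below `c_3` is forced onto the right branch and converges to the fixed
point, which lies above `c_3`. -/
lemma exists_critOrbit_three_le {s : ℝ} (hs : 1 < s) (h2 : 2 < s ^ 2) {x : ℕ → ℝ}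
    (hx : x ∈ coreSpace s) (N : ℕ) : ∃ n, N ≤ n ∧ critOrbit s 3 ≤ x n := by
  by_contra! h
  obtain ⟨n, hn⟩ := ((tendsto_iterate_rightInv hs (x N)).eventually
    (lt_mem_nhds (critOrbit_three_lt_fixedPt hs h2))).exists
  rw [← eq_iterate_rightInv hs hx N n fun i _ => h _ (by omega)] at hn
  exact absurd (h (N + n) (by omega)) (not_lt.2 hn.le)

/-- Every point of the core above `c_3` other than `c_1` has two preimages in the core. -/
lemma exists_other_preimage {s : ℝ} (hs : 1 < s) {q u : ℝ} (hq : q ∈ core s)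
    (h3 : critOrbit s 3 ≤ q) (h1 : q ≠ critOrbit s 1) :
    ∃ v ∈ core s, tent s v = q ∧ v ≠ u := by
  have hs0 : 0 < s := by linarith
  have hq1 := lt_of_le_of_ne hq.2 h1
  have hr : tent s (rightInv s q) = q := tent_rightInv hs hq.2
  rw [critOrbit_one hs] at hq1
  have hlt : q / s < 1 / 2 := by rw [div_lt_iff₀ hs0]; linarith
  by_cases hu : rightInv s q = u
  · refine ⟨q / s, ⟨?_, ?_⟩, ?_, ?_⟩
    · rw [le_div_iff₀ hs0, mul_comm, ← critOrbit_three hs]; exact h3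
    · rw [critOrbit_one hs]; linarith
    · rw [tent_of_le hs hlt.le]; field_simp
    · rw [← hu, rightInv]; intro he; linarith
  · exact ⟨_, rightInv_mem_core hs hq, hr, hu⟩

lemma isCantor_fibre {s : ℝ} (hs : 1 < s) (hs2 : s ≤ 2) (h2 : 2 < s ^ 2) {N : ℕ} {p : ℝ}
    (hp : p ∈ core s) (hav : ∀ k, critOrbit s k ≠ p) :
    IsCantor {y ∈ coreSpace s | y N = p} := by
  have hcl : IsClosed {y : ℕ → ℝ | y N = p} := isClosed_eq (continuous_apply N) continuous_const
  have hcomp : IsCompact {y ∈ coreSpace s | y N = p} := (isCompact_coreSpace s).inter_right hcl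
  refine ⟨⟨coreLift s N p, coreLift_mem hs hs2 hp N, coreLift_self N⟩, hcomp,
    ⟨hcomp.isClosed, fun k hk => ?_⟩, isTotallyDisconnected_fibre hs N p⟩
  rw [accPt_iff_nhds]
  intro U hU
  obtain ⟨J, t, ht, htU⟩ := Filter.mem_pi'.1 (nhds_pi (a := k) ▸ hU)
  -- To see that `k` is not isolated, keep all coordinates that `U` and the fibre see, and switch to
  -- the other preimage at position `n + 1`.
  obtain ⟨n, hn, hn3⟩ := exists_critOrbit_three_le hs h2 hk.1 (max N (J.sup id))
  have hne : k n ≠ critOrbit s 1 := by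
    intro he
    have := invLim_iterate_of_le hk.1 ((le_max_left _ _).trans hn)
    rw [he, iterate_critOrbit, hk.2] at this
    exact hav _ this
  obtain ⟨v, hv, hvk, hvne⟩ := exists_other_preimage hs (u := k (n + 1)) (hk.1.1 n) hn3 hne
  have hagree : ∀ i ≤ n, coreLift s (n + 1) v i = k i := fun i hi => by
    rw [coreLift_of_le (by omega), show n + 1 - i = (n - i) + 1 by omega,
      Function.iterate_succ_apply, hvk, invLim_iterate_of_le hk.1 hi]
  refine ⟨coreLift s (n + 1) v, ⟨htU fun i hi => ?_, coreLift_mem hs hs2 hv _, ?_⟩, ?_⟩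
  · rw [hagree i ((Finset.le_sup (f := id) hi).trans ((le_max_right _ _).trans hn))]
    exact mem_of_mem_nhds (ht i)
  · rw [hagree N ((le_max_left _ _).trans hn), hk.2]
  · intro he
    have := congrFun he (n + 1)
    rw [coreLift_self] at this
    exact hvne this

/-- A neighbourhood of some `x n` misses `c_k` for `k ≥ m`; pulling it back by `T^m` disposes of the
first `m` points as well. -/
lemma exists_interval_avoiding {s : ℝ} {x : ℕ → ℝ} (hx : x ∈ coreSpace s)
    (hxω : x ∉ omegaSpace s) :
    ∃ N δ, 0 < δ ∧ ∀ k, critOrbit s k ∉ Ioo (x N - δ) (x N + δ) := by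
  obtain ⟨n, hn⟩ : ∃ n, x n ∉ omegaCrit s := by
    by_contra! h
    exact hxω ⟨h, hx.2⟩
  rw [mem_omegaCrit, mapClusterPt_iff_frequently] at hn
  push Not at hn
  obtain ⟨V, hV, hVk⟩ := hn
  obtain ⟨m, hm⟩ := eventually_atTop.1 hVk
  have hW : (tent s)^[m] ⁻¹' V ∈ 𝓝 (x (n + m)) := by
    refine ((continuous_tent s).iterate m).continuousAt ?_
    rwa [invLim_iterate hx]
  obtain ⟨δ, hδ, hball⟩ := Metric.mem_nhds_iff.1 hW
  refine ⟨n + m, δ, hδ, fun k hk => ?_⟩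
  rw [← Real.ball_eq_Ioo] at hk
  have := hball hk
  rw [mem_preimage, iterate_critOrbit] at this
  exact hm _ (by omega) this

theorem foldingPoints_subset_omegaSpace {s : ℝ} (hs : 1 < s) (hs2 : s ≤ 2) (h2 : 2 < s ^ 2) :
    foldingPoints s ⊆ omegaSpace s := by
  rintro x ⟨hx, hxF⟩
  by_contra hxω
  obtain ⟨N, δ, hδ, hav⟩ := exists_interval_avoiding hx hxω
  have hxI : x N ∈ Ioo (x N - δ) (x N + δ) := ⟨by linarith, by linarith⟩
  refine hxF ⟨box s N (Ioo (x N - δ) (x N + δ)), fun y hy => hy.1, ?_,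
    {y ∈ coreSpace s | y N = x N}, isCantor_fibre hs hs2 h2 (hx.1 N) ?_,
    ⟨boxHomeomorph hs hs2 N hδ hav⟩⟩
  · exact inter_mem_nhdsWithin _ ((continuous_apply N).continuousAt (isOpen_Ioo.mem_nhds hxI))
  · intro k hk
    exact hav k (hk ▸ hxI)

/-! ### The renormalizable case -/

/-- A point with small connected neighbourhoods has no neighbourhood which is the product of a
Cantor set and an open arc. -/
lemma not_hasCantorArcNhd {E : Type*} [TopologicalSpace E] {Y : Set E} {x : E}
    (hx : x ∈ Y) (h : ∀ V ∈ 𝓝[Y] x, ∃ W ∈ 𝓝[Y] x, W ⊆ V ∧ IsPreconnected W) :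
    ¬ HasCantorArcNhd Y x := by
  rintro ⟨U, hUY, hU, K, hK, ⟨φ⟩⟩
  obtain ⟨W, hW, hWU, hWc⟩ := h U hU
  have hxW : x ∈ W := mem_of_mem_nhdsWithin hx hW
  set x' : U := ⟨x, hWU hxW⟩ with hx'
  have hpre : IsPreconnected ((↑) ⁻¹' W : Set U) := by
    rw [← IsInducing.subtypeVal.isPreconnected_image, Subtype.image_preimage_coe,
      inter_eq_right.2 hWU]
    exact hWc
  have hψ : Continuous fun y : U => ((φ y).1 : ℕ → ℝ) := by fun_prop
  have hsub := hK.2.2.2 _ (by rintro _ ⟨y, -, rfl⟩; exact (φ y).1.2)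
    (hpre.image _ hψ.continuousOn)
  have hconst : ∀ y : U, (y : E) ∈ W → ((φ y).1 : ℕ → ℝ) = (φ x').1 := fun y hy =>
    hsub ⟨y, hy, rfl⟩ ⟨x', hxW, rfl⟩
  -- Moving only the Cantor coordinate a little stays in `W`, where that coordinate is constant; but
  -- `K` has no isolated points.
  have htend : Tendsto (fun k : K => (φ.symm (k, (φ x').2) : E)) (𝓝 (φ x').1) (𝓝[Y] x) := by
    refine tendsto_nhdsWithin_iff.2 ⟨?_, Eventually.of_forall fun k => hUY (φ.symm _).2⟩
    have hc : Continuous fun k : K => (φ.symm (k, (φ x').2) : E) := by fun_prop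
    have := hc.tendsto (φ x').1
    simpa [hx'] using this
  obtain ⟨u, hu, hsubu⟩ := mem_nhds_subtype _ _ _ |>.1 (htend hW)
  obtain ⟨k, ⟨hku, hkK⟩, hne⟩ := accPt_iff_nhds.1 (hK.2.2.1.acc _ (φ x').1.2) u hu
  have h1 := hconst (φ.symm (⟨k, hkK⟩, (φ x').2)) (hsubu (show (⟨k, hkK⟩ : K) ∈ _ from hku))
  rw [Homeomorph.apply_symm_apply] at h1
  exact hne h1

lemma fixedPt_gt {s : ℝ} (hs : 1 < s) : 1 / 2 < fixedPt s := by
  rw [fixedPt, lt_div_iff₀ (by linarith)]; linarith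

lemma fixedPt_lt {s : ℝ} (hs : 1 < s) : fixedPt s < 1 := by
  rw [fixedPt, div_lt_one (by linarith)]; linarith

/-- The right branch maps the `δ`-interval about the fixed point into itself, and below `c_3` it
gives the only preimage in the core. So coordinate `N` determines nearby points, and `X'` is locally
an arc there. -/
lemma mem_foldingPoints_of_near_fixedPt {s : ℝ} (hs : 1 < s) (hs2 : s ≤ 2) {x : ℕ → ℝ}
    (hx : x ∈ coreSpace s) {N : ℕ} {δ : ℝ} (hδ3 : fixedPt s + δ ≤ critOrbit s 3)
    (hδ2 : critOrbit s 2 ≤ fixedPt s - δ) (hxN : |x N - fixedPt s| < δ) : x ∈ foldingPoints s := by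
  have h31 : critOrbit s 3 ≤ critOrbit s 1 := (critOrbit_mem_core hs hs2 3).2
  have hcore : ∀ q, |q - fixedPt s| < δ → q ∈ core s := fun q hq => by
    rw [abs_lt] at hq
    exact ⟨by linarith, by linarith⟩
  have huniq : ∀ y ∈ coreSpace s, |y N - fixedPt s| < δ → y = coreLift s N (y N) := by
    intro y hy hyN
    have hit : ∀ l, |(rightInv s)^[l] (y N) - fixedPt s| < δ := fun l => by
      induction l with
      | zero => exact hyN
      | succ l ih =>
        rw [Function.iterate_succ_apply', abs_rightInv_sub_fixedPt hs]
        exact (div_le_self (abs_nonneg _) hs.le).trans_lt ih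
    have hy' : ∀ l, y (N + l) = (rightInv s)^[l] (y N) := fun l => by
      induction l using Nat.strong_induction_on with
      | _ l ih =>
        refine eq_iterate_rightInv hs hy N l fun i hi => ?_
        rw [ih i hi]
        linarith [(abs_lt.1 (hit i)).2]
    funext i
    rcases le_total i N with h | h
    · rw [coreLift_of_le h, invLim_iterate_of_le hy h]
    · obtain ⟨l, rfl⟩ := Nat.exists_eq_add_of_le h
      rw [coreLift_add, hy']
  refine ⟨hx, not_hasCantorArcNhd hx fun V hV => ?_⟩
  have hnear : {q : ℝ | |q - fixedPt s| < δ} ∈ 𝓝 (x N) :=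
    (isOpen_lt (by fun_prop) continuous_const).mem_nhds hxN
  have htend : Tendsto (coreLift s N) (𝓝 (x N)) (𝓝[coreSpace s] x) := by
    refine tendsto_nhdsWithin_iff.2 ⟨?_, ?_⟩
    · have := (continuous_coreLift s N).tendsto (x N)
      rwa [← huniq x hx hxN] at this
    · filter_upwards [hnear] with q hq using coreLift_mem hs hs2 (hcore q hq) N
  obtain ⟨ε, hε, hball⟩ := Metric.mem_nhds_iff.1 (inter_mem hnear (htend hV))
  refine ⟨coreLift s N '' Metric.ball (x N) ε, ?_, ?_, ?_⟩
  · have h1 : coreSpace s ∩ (fun y : ℕ → ℝ => y N) ⁻¹' Metric.ball (x N) ε ∈ 𝓝[coreSpace s] x :=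
      inter_mem_nhdsWithin _ ((continuous_apply N).continuousAt (Metric.ball_mem_nhds _ hε))
    filter_upwards [h1] with y hy
    exact ⟨y N, hy.2, (huniq y hy.1 (hball hy.2).1).symm⟩
  · rintro _ ⟨q, hq, rfl⟩
    exact (hball hq).2
  · rw [Real.ball_eq_Ioo]
    exact isPreconnected_Ioo.image _ (continuous_coreLift s N).continuousOn

/-- The lift converges to the fixed point, which lies strictly between `c` and `c_3` and below `1`;
this gives both properties. -/
lemma coreLift_mem_inner {s : ℝ} (hs : 1 < s) (hs2 : s ≤ 2) (h2 : s ^ 2 < 2) {q : ℝ}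
    (hq : q ∈ core s) (M : ℕ) :
    coreLift s M q ∈ foldingPoints s \ endpoints (space s) := by
  have hmem := coreLift_mem hs hs2 hq M
  have h3 := fixedPt_lt_critOrbit_three hs h2
  have hc2 := critOrbit_two_le_half hs
  have hp1 := fixedPt_gt hs
  have hp2 := fixedPt_lt hs
  have hlim : ∀ δ > 0, ∃ L, ∀ l ≥ L, |coreLift s M q (M + l) - fixedPt s| < δ := fun δ hδ => by
    obtain ⟨L, hL⟩ := Metric.tendsto_atTop.1 (tendsto_iterate_rightInv hs q) δ hδ
    exact ⟨L, fun l hl => by rw [coreLift_add, ← Real.dist_eq]; exact hL l hl⟩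
  constructor
  · obtain ⟨L, hL⟩ := hlim (min (critOrbit s 3 - fixedPt s) (fixedPt s - critOrbit s 2))
      (lt_min (by linarith) (by linarith))
    refine mem_foldingPoints_of_near_fixedPt hs hs2 hmem ?_ ?_ (hL L le_rfl)
    · linarith [min_le_left (critOrbit s 3 - fixedPt s) (fixedPt s - critOrbit s 2)]
    · linarith [min_le_right (critOrbit s 3 - fixedPt s) (fixedPt s - critOrbit s 2)]
  · have hη : 0 < min ((fixedPt s - 1 / 2) / 2) ((1 - fixedPt s) / 2) :=
      lt_min (by linarith) (by linarith)
    obtain ⟨L, hL⟩ := hlim _ hη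
    refine notMem_endpoints hs hs2 (coreSpace_subset_space hs hs2 hmem) hη (M + L)
      fun n hn => ?_
    obtain ⟨l, rfl⟩ := Nat.exists_eq_add_of_le hn
    have h := abs_lt.1 (hL (L + l) (by omega))
    rw [← Nat.add_assoc] at h
    have h4 := min_le_left ((fixedPt s - 1 / 2) / 2) ((1 - fixedPt s) / 2)
    have h5 := min_le_right ((fixedPt s - 1 / 2) / 2) ((1 - fixedPt s) / 2)
    exact ⟨le_abs.2 (Or.inl (by linarith)), by linarith, by linarith⟩

theorem coreSpace_subset_closure {s : ℝ} (hs : 1 < s) (hs2 : s ≤ 2) (h2 : s ^ 2 < 2) :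
    coreSpace s ⊆ closure (foldingPoints s \ endpoints (space s)) := by
  intro y hy
  refine mem_closure_of_forall_coord hy (fun x hx => hx.1.1) fun M => ?_
  exact subset_closure ⟨_, coreLift_mem_inner hs hs2 h2 (hy.1 M) M, coreLift_self M⟩

end TentInverseLimit

end

/-! ### The two density statements -/

theorem proposition4p8 (s : ℝ) (hs1 : 1 < s) (hs2 : s ≤ 2)
    (horb : (Set.range (TentInverseLimit.critOrbit s)).Infinite) :
    ((TentInverseLimit.foldingPoints s \
          TentInverseLimit.endpoints (TentInverseLimit.space s)).Nonempty →
      TentInverseLimit.foldingPoints s ⊆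
        closure (TentInverseLimit.foldingPoints s \
          TentInverseLimit.endpoints (TentInverseLimit.space s))) ∧
    ((TentInverseLimit.omegaSpace s \
          TentInverseLimit.endpoints (TentInverseLimit.space s)).Nonempty →
      TentInverseLimit.omegaSpace s ⊆
        closure (TentInverseLimit.omegaSpace s \
          TentInverseLimit.endpoints (TentInverseLimit.space s))) := by
  have hlt := TentInverseLimit.lt_two hs1 hs2 horb
  refine ⟨fun hne => ?_, TentInverseLimit.omegaSpace_subset_closure hs1 hlt⟩
  rcases lt_or_gt_of_ne (TentInverseLimit.sq_ne_two hs1 horb) with h2 | h2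
  · exact fun x hx => TentInverseLimit.coreSpace_subset_closure hs1 hs2 h2 hx.1
  · have hF : TentInverseLimit.foldingPoints s = TentInverseLimit.omegaSpace s :=
      (TentInverseLimit.foldingPoints_subset_omegaSpace hs1 hs2 h2).antisymm
        (TentInverseLimit.omegaSpace_subset_foldingPoints hs1 hs2)
    rw [hF] at hne ⊢
    exact TentInverseLimit.omegaSpace_subset_closure hs1 hlt hne
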